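/- Let $1\le n\le 3$, let $\Omega\subset\mathbb R^n$ be a bounded Lipschitz domain (open, bounded, connected, and locally near each boundary point the set strictly below the graph of a Lipschitz function), let $\alpha,\beta>0$ and $T>0$, let $c:\mathbb R\to\mathbb R$ be continuous and let $d:\mathbb R\to\mathbb R$ be continuously differentiable. Let $S\in C^{1,2}([0,T]\times\overline\Omega)$, i.e. $S$, $\partial_tS$ and the first and second derivatives of $S$ in $x$ exist and are continuous on $[0,T]\times\overline\Omega$. Suppose that $S$ is a smooth solution of the Neumann problem, i.e. that for all $0<t\le T$ it satisfies pointwise $$c(|\nabla S|)\,\partial_tS=\operatorname{div}(\alpha\nabla S)-\beta\,d'(S)\quad\text{in }\Omega,$$ and $\alpha\,\partial_\nu S=0$ at every point of $\partial\Omega$ at which $\Omega$ has an outer unit normal $\nu$ (this is the case almost everywhere on $\partial\Omega$). Then for all $v\in H^1(\Omega)$ and all $0<t\le T$, $$\big(c(|\nabla S(t)|)\,\partial_tS(t),v\big)+\big(\alpha\nabla S(t),\nabla v\big)+\big(\beta\,d'(S(t)),v\big)=0,$$ where $(u,w)=\int_\Omega u\cdot w\,dx$ is the $L^2(\Omega)$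 scalar product, $\nabla v$ is the weak gradient of $v$, and the three integrands are integrable. -/

import Mathlib

open Set MeasureTheory Metric Topology
open scoped ContDiff Gradient

/-- A bounded Lipschitz domain in `ℝⁿ`: a bounded, open, connected set such that near each boundary
point, for a suitable unit vector `ν` (the local vertical direction), the set consists of the points
lying strictly below the graph of a Lipschitz function `γ` over the hyperplane `ν^⊥`. -/
structure IsBoundedLipschitzDomain {n : ℕ} (Ω : Set (EuclideanSpace ℝ (Fin n))) : Prop where
  isOpen : IsOpen Ω
  isConnected : IsConnected Ω
  isBounded : Bornology.IsBounded Ω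
  locally_subgraph : ∀ x ∈ frontier Ω, ∃ ν : EuclideanSpace ℝ (Fin n), ‖ν‖ = 1 ∧
    ∃ (γ : (ℝ ∙ ν)ᗮ → ℝ) (K : NNReal) (r : ℝ), LipschitzWith K γ ∧ 0 < r ∧
      ∀ y ∈ ball x r, y ∈ Ω ↔ inner ℝ ν y < γ ((ℝ ∙ ν)ᗮ.orthogonalProjectionOnto y)

/-- `ν` is the outer unit normal of `Ω` at `x`: every closed cone around `-ν` narrower than the
half-space `⟪ν, y - x⟫ < 0` lies inside `Ω` near `x`, and every such cone around `ν` lies outside.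
For a set that is near `x` the subgraph of a Lipschitz function, such a `ν` exists exactly when that
function is differentiable at the base point of `x` (hence at almost every boundary point), and it is
then the usual normalized vector `(-∇γ, 1)`. -/
def IsOuterUnitNormal {n : ℕ} (Ω : Set (EuclideanSpace ℝ (Fin n)))
    (x ν : EuclideanSpace ℝ (Fin n)) : Prop :=
  ‖ν‖ = 1 ∧ ∀ ε > 0, ∃ δ > 0, ∀ y ∈ ball x δ, y ≠ x →
    (inner ℝ ν (y - x) ≤ -ε * ‖y - x‖ → y ∈ Ω) ∧
    (ε * ‖y - x‖ ≤ inner ℝ ν (y - x) → y ∉ Ω)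

/-- The divergence `∑ᵢ ∂ᵢ Fᵢ` of a vector field. -/
noncomputable def divergence {n : ℕ}
    (F : EuclideanSpace ℝ (Fin n) → EuclideanSpace ℝ (Fin n)) (x : EuclideanSpace ℝ (Fin n)) : ℝ :=
  ∑ i, (fderiv ℝ F x (EuclideanSpace.single i 1)) i

/-- The time derivative `∂ₜ S (t, x)` on `[0, T]` (one-sided at the end points). -/
noncomputable def timeDeriv {n : ℕ} (T : ℝ) (S : ℝ → EuclideanSpace ℝ (Fin n) → ℝ)
    (t : ℝ) (x : EuclideanSpace ℝ (Fin n)) : ℝ :=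
  derivWithin (fun s => S s x) (Icc 0 T) t

/-- The class `C^{1,2}([0,T] × closure Ω)`: `S` is continuous, `∂ₜ S` and the first and second space
derivatives exist on `[0,T] × closure Ω` and are continuous there. -/
structure IsC12 {n : ℕ} (T : ℝ) (Ω : Set (EuclideanSpace ℝ (Fin n)))
    (S : ℝ → EuclideanSpace ℝ (Fin n) → ℝ) : Prop where
  continuousOn : ContinuousOn (fun p : ℝ × EuclideanSpace ℝ (Fin n) => S p.1 p.2)
    (Icc 0 T ×ˢ closure Ω)
  differentiableOn_time : ∀ x ∈ closure Ω, DifferentiableOn ℝ (fun s => S s x) (Icc 0 T)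
  continuousOn_timeDeriv : ContinuousOn
    (fun p : ℝ × EuclideanSpace ℝ (Fin n) => timeDeriv T S p.1 p.2) (Icc 0 T ×ˢ closure Ω)
  contDiffOn_space : ∀ t ∈ Icc 0 T, ContDiffOn ℝ 2 (S t) (closure Ω)
  continuousOn_fderiv : ContinuousOn
    (fun p : ℝ × EuclideanSpace ℝ (Fin n) => fderivWithin ℝ (S p.1) (closure Ω) p.2)
    (Icc 0 T ×ˢ closure Ω)
  continuousOn_fderiv_fderiv : ContinuousOn
    (fun p : ℝ × EuclideanSpace ℝ (Fin n) =>
      fderivWithin ℝ (fun y => fderivWithin ℝ (S p.1) (closure Ω) y) (closure Ω) p.2)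
    (Icc 0 T ×ˢ closure Ω)

/-- `S` is a smooth solution on `[0, T]` of the Neumann problem
`c(|∇S|) ∂ₜS = div (α ∇S) - β d'(S)` in `Ω`, `α ∂ₙS = 0` on `∂Ω`, for `t > 0`. The boundary condition
is imposed at every boundary point at which the domain has an outer unit normal. -/
structure IsSmoothSolution {n : ℕ} (T : ℝ) (Ω : Set (EuclideanSpace ℝ (Fin n))) (α β : ℝ)
    (c d : ℝ → ℝ) (S : ℝ → EuclideanSpace ℝ (Fin n) → ℝ) : Prop where
  isC12 : IsC12 T Ω S
  equation : ∀ t ∈ Ioc 0 T, ∀ x ∈ Ω,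
    c ‖∇ (S t) x‖ * timeDeriv T S t x =
      divergence (fun y => α • ∇ (S t) y) x - β * deriv d (S t x)
  neumann : ∀ t ∈ Ioc 0 T, ∀ x ∈ frontier Ω, ∀ ν, IsOuterUnitNormal Ω x ν →
    α * fderivWithin ℝ (S t) (closure Ω) x ν = 0

/-- `v` belongs to the Sobolev space `H¹(Ω)` and `g` is its weak gradient: `v` and `g` are square
integrable on `Ω` and `∫_Ω v ∂ᵢφ = -∫_Ω gᵢ φ` for all test functions `φ ∈ C_c^∞(Ω)` and all `i`. -/
structure IsH1WithGradient {n : ℕ} (Ω : Set (EuclideanSpace ℝ (Fin n)))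
    (v : EuclideanSpace ℝ (Fin n) → ℝ)
    (g : EuclideanSpace ℝ (Fin n) → EuclideanSpace ℝ (Fin n)) : Prop where
  memLp : MemLp v 2 (volume.restrict Ω)
  memLp_gradient : MemLp g 2 (volume.restrict Ω)
  integral_eq : ∀ φ : EuclideanSpace ℝ (Fin n) → ℝ, ContDiff ℝ ∞ φ → HasCompactSupport φ →
    tsupport φ ⊆ Ω → ∀ i,
      ∫ x in Ω, v x * fderiv ℝ φ x (EuclideanSpace.single i 1) = -∫ x in Ω, g x i * φ x

/-! Multiplied by `v` and integrated, the equation reduces to `∫ div F v + F · ∇v = 0` for `F =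
∇S(t)`, a field whose derivative is bounded and whose normal component vanishes on the boundary. No
trace of `v` is needed, because the boundary is approached by cutoffs. If `w` is Lipschitz with
compact support in `Ω`, testing the weak gradient with the components of `wF` gives `∫ div (wF) v +
wF · ∇v = 0` (`integral_fluxIntegrand_of_compactSupport`); mollification extends the test class from
smooth to Lipschitz functions. Near the boundary `Ω = {h > 0}` for a Lipschitz height `h`. Take `w =
ψ θ(h/ε - 1)`; the dangerous term is `θ' ε⁻¹ ∇h · F`, supported where `h ≤ 2ε`. Tangency gives `|∇h
· F| ≤ L C h` (`abs_fderiv_height_le`), so this term is bounded uniformly in `ε`, and dominated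
convergence removes the cutoff. Compactness of the closure then glues the local identities. -/

/-- The product of two bounded real Lipschitz functions is Lipschitz. -/
theorem exists_lipschitzWith_mul {X : Type*} [PseudoMetricSpace X] {f g : X → ℝ} {C D : NNReal}
    {A B : ℝ} (hf : LipschitzWith C f) (hg : LipschitzWith D g) (hA : ∀ x, |f x| ≤ A)
    (hB : ∀ x, |g x| ≤ B) : ∃ L, LipschitzWith L (fun x => f x * g x) := by
  refine ⟨(|A| * D + |B| * C).toNNReal, LipschitzWith.of_dist_le_mul fun x y => ?_⟩
  rw [Real.coe_toNNReal _ (by positivity), Real.dist_eq]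
  have h1 : f x * g x - f y * g y = f x * (g x - g y) + g y * (f x - f y) := by ring
  have hgd := hg.dist_le_mul x y
  have hfd := hf.dist_le_mul x y
  rw [Real.dist_eq] at hgd hfd
  calc |f x * g x - f y * g y| ≤ |f x| * |g x - g y| + |g y| * |f x - f y| := by
        rw [h1, ← abs_mul, ← abs_mul]; exact abs_add_le _ _
    _ ≤ |A| * (D * dist x y) + |B| * (C * dist x y) := by
        gcongr ?_ * ?_ + ?_ * ?_
        · exact (hA x).trans (le_abs_self A)
        · exact (hB y).trans (le_abs_self B)
    _ = _ := by ring

/-! ### Weak derivatives tested with Lipschitz functions -/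

section Mollification

variable {E : Type*} [NormedAddCommGroup E] [NormedSpace ℝ E] [FiniteDimensional ℝ E]
  [MeasurableSpace E] [BorelSpace E] {μ : Measure E} [μ.IsAddHaarMeasure]

/-- The derivative of the convolution of a test function with a Lipschitz function is the
convolution with the line derivative. -/
theorem fderiv_convolution_of_lipschitz {φ w : E → ℝ} {C : NNReal} (hφ : ContDiff ℝ ∞ φ)
    (hφc : HasCompactSupport φ) (hw : LipschitzWith C w) (x e : E) :
    fderiv ℝ (convolution φ w (ContinuousLinearMap.lsmul ℝ ℝ) μ) x e =
      convolution φ (fun y => lineDeriv ℝ w y e) (ContinuousLinearMap.lsmul ℝ ℝ) μ x := by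
  have hsm : ContDiff ℝ ∞ (convolution φ w (ContinuousLinearMap.lsmul ℝ ℝ) μ) :=
    hφc.contDiff_convolution_left _ hφ hw.continuous.locallyIntegrable
  have h1 := ((hsm.differentiable (by simp) x).hasFDerivAt.hasLineDerivAt e).tendsto_slope_zero_right
  have hφx : Continuous fun t => φ (x - t) := hφ.continuous.comp (by fun_prop)
  have hφxc : HasCompactSupport fun t => φ (x - t) :=
    hφc.comp_homeomorph (Homeomorph.subLeft x)
  have h2 := hw.integral_inv_smul_sub_mul_tendsto_integral_lineDeriv_mul
    (hφx.integrable_of_hasCompactSupport hφxc) (μ := μ) e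
  have h3 : convolution φ (fun y => lineDeriv ℝ w y e) (ContinuousLinearMap.lsmul ℝ ℝ) μ x =
      ∫ t, lineDeriv ℝ w t e * φ (x - t) ∂μ := by
    rw [convolution_eq_swap]
    simp [mul_comm]
  rw [h3]
  -- `h1` and `h2` are limits of the same difference quotient: the substitution `t ↦ x - t` moves
  -- the increment from the kernel onto `w`.
  refine tendsto_nhds_unique h1 (h2.congr fun s => ?_)
  have h4 : convolution φ w (ContinuousLinearMap.lsmul ℝ ℝ) μ (x + s • e) =
      ∫ t, w (t + s • e) * φ (x - t) ∂μ := by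
    rw [convolution_def, ← integral_sub_left_eq_self _ μ x]
    refine integral_congr_ae (.of_forall fun t => ?_)
    simp only [ContinuousLinearMap.lsmul_apply, smul_eq_mul]
    rw [mul_comm]
    congr 2
    abel
  have h5 : convolution φ w (ContinuousLinearMap.lsmul ℝ ℝ) μ x = ∫ t, w t * φ (x - t) ∂μ := by
    rw [convolution_eq_swap]
    simp [mul_comm]
  have hi : ∀ a : E, Integrable (fun t => w (t + a) * φ (x - t)) μ := fun a =>
    ((hw.continuous.comp (by fun_prop : Continuous fun t => t + a)).mul
      hφx).integrable_of_hasCompactSupport hφxc.mul_left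
  rw [h4, h5, ← integral_sub (hi _) (by simpa using hi 0), smul_eq_mul, ← integral_const_mul]
  refine integral_congr_ae (.of_forall fun t => ?_)
  simp only [smul_eq_mul]
  ring

/-- The kernel is nonnegative with mass one. This supplies the dominating functions for
mollification. -/
theorem abs_normed_convolution_le (φ : ContDiffBump (0 : E)) {g : E → ℝ} {M : ℝ}
    (hg : ∀ x, |g x| ≤ M) (x : E) :
    |convolution (φ.normed μ) g (ContinuousLinearMap.lsmul ℝ ℝ) μ x| ≤ M := by
  rw [convolution_def, ← Real.norm_eq_abs]
  refine (norm_integral_le_of_norm_le (g := fun t => φ.normed μ t * M)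
    (φ.integrable_normed.mul_const M) (.of_forall fun t => ?_)).trans ?_
  · simp only [ContinuousLinearMap.lsmul_apply, smul_eq_mul, norm_mul, Real.norm_eq_abs]
    rw [abs_of_nonneg (φ.nonneg_normed t)]
    exact mul_le_mul_of_nonneg_left (hg _) (φ.nonneg_normed t)
  · rw [integral_mul_const, φ.integral_normed, one_mul]

/-- A weak derivative may be tested against compactly supported Lipschitz functions. -/
theorem setIntegral_mul_fderiv_of_lipschitz {Ω : Set E} (hΩ : IsOpen Ω) {v g : E → ℝ} {e : E}
    (hv : IntegrableOn v Ω μ) (hg : IntegrableOn g Ω μ)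
    (hvg : ∀ φ : E → ℝ, ContDiff ℝ ∞ φ → HasCompactSupport φ → tsupport φ ⊆ Ω →
      ∫ x in Ω, v x * fderiv ℝ φ x e ∂μ = -∫ x in Ω, g x * φ x ∂μ)
    {w : E → ℝ} {C : NNReal} (hw : LipschitzWith C w) (hwc : HasCompactSupport w)
    (hwΩ : tsupport w ⊆ Ω) :
    ∫ x in Ω, v x * fderiv ℝ w x e ∂μ = -∫ x in Ω, g x * w x ∂μ := by
  obtain ⟨δ, hδ, hδΩ⟩ := hwc.isCompact.exists_cthickening_subset_open hΩ hwΩ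
  -- Outer radius at most `δ` keeps the mollified supports inside `Ω`; the fixed ratio 2 of the
  -- radii is what almost everywhere convergence requires.
  let φ : ℕ → ContDiffBump (0 : E) := fun k =>
    ⟨δ / (k + 1) / 2, δ / (k + 1), by positivity, half_lt_self (by positivity)⟩
  have hφ0 : Filter.Tendsto (fun k => (φ k).rOut) Filter.atTop (𝓝 0) := by
    have := (tendsto_one_div_add_atTop_nhds_zero_nat (𝕜 := ℝ)).const_mul δ
    simpa [φ, div_eq_mul_inv] using this
  have hφ2 : ∀ k, (φ k).rOut ≤ 2 * (φ k).rIn := fun k => by simp only [φ]; linarith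
  have hφδ : ∀ k, (φ k).rOut ≤ δ := fun k => div_le_self hδ.le (by simp)
  let W : ℕ → E → ℝ := fun k =>
    convolution ((φ k).normed μ) w (ContinuousLinearMap.lsmul ℝ ℝ) μ
  have hWsm : ∀ k, ContDiff ℝ ∞ (W k) := fun k =>
    (φ k).hasCompactSupport_normed.contDiff_convolution_left _ (φ k).contDiff_normed
      hw.continuous.locallyIntegrable
  have hWc : ∀ k, HasCompactSupport (W k) := fun k =>
    (φ k).hasCompactSupport_normed.convolution _ hwc
  have hWΩ : ∀ k, tsupport (W k) ⊆ Ω := fun k => by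
    refine (closure_minimal ?_ isClosed_cthickening).trans hδΩ
    intro x hx
    obtain ⟨a, ha, b, hb, rfl⟩ := support_convolution_subset _ hx
    rw [(φ k).support_normed_eq, mem_ball_zero_iff] at ha
    refine mem_cthickening_of_dist_le _ b _ _ (subset_tsupport _ hb) ?_
    simpa [dist_eq_norm] using ha.le.trans (hφδ k)
  obtain ⟨M, hM⟩ := hw.continuous.bounded_above_of_compact_support hwc
  have hline : ∀ y, |lineDeriv ℝ w y e| ≤ C * ‖e‖ := fun y =>
    norm_lineDeriv_le_of_lipschitz ℝ hw
  have hfd : ∀ k x, fderiv ℝ (W k) x e = convolution ((φ k).normed μ)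
      (fun y => lineDeriv ℝ w y e) (ContinuousLinearMap.lsmul ℝ ℝ) μ x := fun k x =>
    fderiv_convolution_of_lipschitz (φ k).contDiff_normed (φ k).hasCompactSupport_normed hw x e
  have hL : Filter.Tendsto (fun k => ∫ x in Ω, v x * fderiv ℝ (W k) x e ∂μ) Filter.atTop
      (𝓝 (∫ x in Ω, v x * fderiv ℝ w x e ∂μ)) := by
    refine tendsto_integral_of_dominated_convergence (fun x => ‖v x‖ * (C * ‖e‖)) (fun k => ?_)
      (hv.norm.mul_const _) (fun k => .of_forall fun x => ?_) ?_
    · exact hv.aestronglyMeasurable.mul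
        (measurable_fderiv_apply_const ℝ (W k) e).aestronglyMeasurable
    · rw [norm_mul, hfd]
      exact mul_le_mul_of_nonneg_left (abs_normed_convolution_le _ hline x) (norm_nonneg _)
    · refine ae_restrict_of_ae ?_
      -- Almost everywhere the mollified line derivative converges, and by Rademacher's theorem its
      -- limit is the Fréchet derivative in direction `e`.
      filter_upwards [ContDiffBump.ae_convolution_tendsto_right_of_locallyIntegrable (μ := μ) hφ0
        (.of_forall hφ2) (hw.locallyIntegrable_lineDeriv e), hw.ae_differentiableAt] with x hx hdx
      rw [← hdx.lineDeriv_eq_fderiv]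
      simp only [hfd]
      exact hx.const_mul _
  have hR : Filter.Tendsto (fun k => -∫ x in Ω, g x * W k x ∂μ) Filter.atTop
      (𝓝 (-∫ x in Ω, g x * w x ∂μ)) := by
    refine (tendsto_integral_of_dominated_convergence (fun x => ‖g x‖ * M) (fun k => ?_)
      (hg.norm.mul_const _) (fun k => .of_forall fun x => ?_) (.of_forall fun x => ?_)).neg
    · exact hg.aestronglyMeasurable.mul (hWsm k).continuous.aestronglyMeasurable
    · rw [norm_mul]
      exact mul_le_mul_of_nonneg_left (abs_normed_convolution_le _ hM x) (norm_nonneg _)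
    · exact (ContDiffBump.convolution_tendsto_right_of_continuous hφ0 hw.continuous x).const_mul _
  refine tendsto_nhds_unique hL (hR.congr fun k => ?_)
  exact (hvg (W k) (hWsm k) (hWc k) (hWΩ k)).symm

end Mollification

/-! ### The flux identity for compactly supported cutoffs -/

/-- The integrand of `∫ div (ψ F) v + ψ F · g`. -/
noncomputable def fluxIntegrand {n : ℕ}
    (F : EuclideanSpace ℝ (Fin n) → EuclideanSpace ℝ (Fin n)) (v : EuclideanSpace ℝ (Fin n) → ℝ)
    (g : EuclideanSpace ℝ (Fin n) → EuclideanSpace ℝ (Fin n))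
    (ψ : EuclideanSpace ℝ (Fin n) → ℝ) (x : EuclideanSpace ℝ (Fin n)) : ℝ :=
  (ψ x * divergence F x + fderiv ℝ ψ x (F x)) * v x + ψ x * inner ℝ (F x) (g x)

theorem exists_smooth_eq_one_of_compact {E : Type*} [NormedAddCommGroup E] [NormedSpace ℝ E]
    [FiniteDimensional ℝ E] {K Ω : Set E} (hK : IsCompact K) (hΩ : IsOpen Ω) (hKΩ : K ⊆ Ω) :
    ∃ η : E → ℝ, ContDiff ℝ ∞ η ∧ HasCompactSupport η ∧ tsupport η ⊆ Ω ∧ ∀ x ∈ K, η x = 1 := by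
  obtain ⟨δ, hδ, hδΩ⟩ := hK.exists_cthickening_subset_open hΩ hKΩ
  obtain ⟨η, hη, -, hsupp, hone⟩ := exists_contMDiff_support_eq_eq_one_iff 
    (n := (⊤ : ℕ∞)) (modelWithCornersSelf ℝ E) (isOpen_thickening (δ := δ) (E := K)) hK.isClosed
    (self_subset_thickening hδ K)
  have hts : tsupport η ⊆ cthickening δ K := by
    rw [tsupport, hsupp]
    exact closure_thickening_subset_cthickening δ K
  exact ⟨η, contMDiff_iff_contDiff.1 hη, hK.cthickening.of_isClosed_subset (isClosed_tsupport _) hts,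
    hts.trans hδΩ, fun x hx => (hone x).1 hx⟩

/-- Summing over `i` the weak derivative identities for the test functions `w F i` produces the
product rule for `div (wF)`. Since `F` is regular only in `Ω`, it is first multiplied by a smooth
`η` that is 1 on the support of `w`. -/
theorem integral_fluxIntegrand_of_compactSupport {n : ℕ} {Ω : Set (EuclideanSpace ℝ (Fin n))}
    (hΩ : IsOpen Ω) {F : EuclideanSpace ℝ (Fin n) → EuclideanSpace ℝ (Fin n)}
    (hF : ContDiffOn ℝ 1 F Ω) {v : EuclideanSpace ℝ (Fin n) → ℝ}
    {g : EuclideanSpace ℝ (Fin n) → EuclideanSpace ℝ (Fin n)}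
    (hvg : IsH1WithGradient Ω v g) (hv : IntegrableOn v Ω) (hg : IntegrableOn g Ω)
    {w : EuclideanSpace ℝ (Fin n) → ℝ} {C : NNReal} (hw : LipschitzWith C w)
    (hwc : HasCompactSupport w) (hwΩ : tsupport w ⊆ Ω) :
    ∫ x in Ω, fluxIntegrand F v g w x = 0 := by
  obtain ⟨η, hη, hηc, hηΩ, hη1⟩ := exists_smooth_eq_one_of_compact hwc.isCompact hΩ hwΩ
  have hFi : ∀ i, ContDiffOn ℝ 1 (fun x => F x i) Ω := fun i =>
    (contDiffOn_euclidean.1 hF) i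
  let u : Fin n → EuclideanSpace ℝ (Fin n) → ℝ := fun i x => η x * F x i
  have hu : ∀ i, ContDiff ℝ 1 (u i) := fun i => by
    refine contDiff_iff_contDiffAt.2 fun x => ?_
    by_cases hx : x ∈ tsupport (u i)
    swap
    · exact contDiffAt_const.congr_of_eventuallyEq (notMem_tsupport_iff_eventuallyEq.1 hx)
    have hxΩ : x ∈ Ω := hηΩ (closure_mono (Function.support_mul_subset_left _ _) hx)
    exact (hη.of_le (by simp)).contDiffAt.mul ((hFi i).contDiffAt (hΩ.mem_nhds hxΩ))
  have huc : ∀ i, HasCompactSupport (u i) := fun i => hηc.mul_right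
  have hf : ∀ i, ∃ L, LipschitzWith L (fun x => w x * u i x) := fun i => by
    obtain ⟨D, hD⟩ := (hu i).lipschitzWith_of_hasCompactSupport (huc i) (by simp)
    obtain ⟨A, hA⟩ := hw.continuous.bounded_above_of_compact_support hwc
    obtain ⟨B, hB⟩ := (hu i).continuous.bounded_above_of_compact_support (huc i)
    exact exists_lipschitzWith_mul hw hD hA hB
  choose L hL using hf
  have hfc : ∀ i, HasCompactSupport (fun x => w x * u i x) := fun i => hwc.mul_right
  have hfΩ : ∀ i, tsupport (fun x => w x * u i x) ⊆ Ω := fun i =>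
    (closure_mono (Function.support_mul_subset_left _ _)).trans hwΩ
  have hgi : ∀ i, IntegrableOn (fun x => g x i) Ω := fun i =>
    (EuclideanSpace.proj (𝕜 := ℝ) i).integrable_comp hg
  have key : ∀ i, (∫ x in Ω, v x * fderiv ℝ (fun x => w x * u i x) x
      (EuclideanSpace.single i 1)) + ∫ x in Ω, g x i * (w x * u i x) = 0 := fun i => by
    rw [setIntegral_mul_fderiv_of_lipschitz hΩ hv (hgi i)
      (fun φ h1 h2 h3 => hvg.integral_eq φ h1 h2 h3 i) (hL i) (hfc i) (hfΩ i)]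
    simp
  have hi1 : ∀ i, IntegrableOn (fun x => v x * fderiv ℝ (fun x => w x * u i x) x
      (EuclideanSpace.single i 1)) Ω := fun i => by
    refine hv.mul_bdd (c := L i) (measurable_fderiv_apply_const ℝ _ _).aestronglyMeasurable
      (.of_forall fun x => ?_)
    refine (ContinuousLinearMap.le_opNorm _ _).trans ?_
    simpa using norm_fderiv_le_of_lipschitz ℝ (hL i) (x₀ := x)
  have hi2 : ∀ i, IntegrableOn (fun x => g x i * (w x * u i x)) Ω := fun i => by
    obtain ⟨A, hA⟩ := (hL i).continuous.bounded_above_of_compact_support (hfc i)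
    exact (hgi i).mul_bdd (c := A) (hL i).continuous.aestronglyMeasurable (.of_forall hA)
  have hsum : ∫ x in Ω, fluxIntegrand F v g w x = ∫ x in Ω, ∑ i,
      (v x * fderiv ℝ (fun x => w x * u i x) x (EuclideanSpace.single i 1) +
        g x i * (w x * u i x)) := by
    refine setIntegral_congr_ae hΩ.measurableSet ?_
    filter_upwards [hw.ae_differentiableAt (μ := volume)] with x hdw hxΩ
    have hdF : DifferentiableAt ℝ F x := (hF.contDiffAt (hΩ.mem_nhds hxΩ)).differentiableAt (by simp)
    have hFx : F x = ∑ i, F x i • EuclideanSpace.single i (1 : ℝ) := by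
      ext j
      simp [Finset.sum_apply, Pi.single_apply]
    have h1 : ∀ i, w x * u i x = w x * F x i := fun i => by
      by_cases hx : w x = 0
      · simp [hx]
      · simp [u, hη1 x (subset_tsupport _ hx)]
    have h2 : ∀ i, fderiv ℝ (fun x => w x * u i x) x (EuclideanSpace.single i 1) =
        w x * (fderiv ℝ F x (EuclideanSpace.single i 1)) i +
          F x i * fderiv ℝ w x (EuclideanSpace.single i 1) := fun i => by
      have hdu : DifferentiableAt ℝ (u i) x := (hu i).differentiable (by simp) x
      rw [fderiv_fun_mul hdw hdu]
      -- If `w x ≠ 0`, then `w` is nonzero nearby, so `η = 1` nearby and `u i` has the derivative of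
      -- `F i`; if `w x = 0` both sides vanish.
      have h3 : w x * fderiv ℝ (u i) x (EuclideanSpace.single i 1) =
          w x * (fderiv ℝ F x (EuclideanSpace.single i 1)) i := by
        by_cases hx : w x = 0
        · simp [hx]
        · have hev : u i =ᶠ[𝓝 x] fun y => F y i := by
            filter_upwards [hw.continuous.continuousAt.eventually_ne hx] with y hy
            simp [u, hη1 y (subset_tsupport _ hy)]
          have hd := ((EuclideanSpace.proj (𝕜 := ℝ) i : EuclideanSpace ℝ (Fin n) →L[ℝ] ℝ).hasFDerivAt.comp x
            hdF.hasFDerivAt).fderiv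
          rw [hev.fderiv_eq]
          congr 1
          exact congrArg (fun T => T (EuclideanSpace.single i 1)) hd
      have h4 : u i x * fderiv ℝ w x (EuclideanSpace.single i 1) =
          F x i * fderiv ℝ w x (EuclideanSpace.single i 1) := by
        by_cases hx : x ∈ tsupport w
        · simp [u, hη1 x hx]
        · have : fderiv ℝ w x = 0 := by
            have h0 : w =ᶠ[𝓝 x] fun _ => 0 := notMem_tsupport_iff_eventuallyEq.1 hx
            rw [h0.fderiv_eq]; simp
          simp [this]
      simp only [add_apply, smul_apply, smul_eq_mul]
      rw [h3, h4]
    have h5 : fderiv ℝ w x (F x) = ∑ i, F x i * fderiv ℝ w x (EuclideanSpace.single i 1) := by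
      conv_lhs => rw [hFx]
      simp
    have h6 : inner ℝ (F x) (g x) = ∑ i, g x i * F x i := by
      simp [PiLp.inner_apply]
    simp only [fluxIntegrand, divergence, h1, h2, h5, h6]
    rw [Finset.mul_sum, Finset.mul_sum, ← Finset.sum_add_distrib, Finset.sum_mul,
      ← Finset.sum_add_distrib]
    refine Finset.sum_congr rfl fun i _ => ?_
    ring
  rw [hsum, integral_finsetSum]
  swap
  · exact fun i _ => (hi1 i).add (hi2 i)
  refine Finset.sum_eq_zero fun i _ => ?_
  rw [integral_add (hi1 i) (hi2 i), key i]

/-- The derivative is continuous and vanishes outside `[0, 1]`. The constant bounds `θ'` uniformly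
over all cutoff scales. -/
theorem exists_lipschitzWith_smoothTransition : ∃ M, LipschitzWith M Real.smoothTransition := by
  have hd : Differentiable ℝ Real.smoothTransition :=
    (Real.smoothTransition.contDiff (n := 1)).differentiable (by simp)
  have hc : Continuous (deriv Real.smoothTransition) :=
    (Real.smoothTransition.contDiff (n := 1)).continuous_deriv (by simp)
  obtain ⟨M, hM⟩ := isCompact_Icc.exists_bound_of_continuousOn (s := Icc (0 : ℝ) 1)
    hc.continuousOn
  have hM0 : 0 ≤ M := (norm_nonneg _).trans (hM 0 (by simp))
  refine ⟨⟨M, hM0⟩, lipschitzWith_of_nnnorm_deriv_le hd fun x => ?_⟩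
  change ‖deriv Real.smoothTransition x‖ ≤ M
  by_cases hx : x ∈ Icc (0 : ℝ) 1
  · exact hM x hx
  have hz : deriv Real.smoothTransition x = 0 := by
    rcases lt_or_ge x 0 with h | h
    · have : Real.smoothTransition =ᶠ[𝓝 x] fun _ => 0 := by
        filter_upwards [Iio_mem_nhds h] with y hy
        exact Real.smoothTransition.zero_of_nonpos (le_of_lt hy)
      rw [this.deriv_eq, deriv_const]
    · have h1 : 1 < x := not_le.1 fun h' => hx ⟨h, h'⟩
      have : Real.smoothTransition =ᶠ[𝓝 x] fun _ => 1 := by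
        filter_upwards [Ioi_mem_nhds h1] with y hy
        exact Real.smoothTransition.one_of_one_le (le_of_lt hy)
      rw [this.deriv_eq, deriv_const]
  simpa [hz] using hM0

/-! ### Height functions and the decay of the normal component -/

/-- Near a boundary point, a Lipschitz domain is the positivity set of a Lipschitz function that is
affine in the vertical direction. -/
theorem IsBoundedLipschitzDomain.exists_height {n : ℕ} {Ω : Set (EuclideanSpace ℝ (Fin n))}
    (hΩ : IsBoundedLipschitzDomain Ω) {x : EuclideanSpace ℝ (Fin n)} (hx : x ∈ frontier Ω) :
    ∃ (ν : EuclideanSpace ℝ (Fin n)) (h : EuclideanSpace ℝ (Fin n) → ℝ) (L : NNReal) (r : ℝ),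
      ‖ν‖ = 1 ∧ LipschitzWith L h ∧ 0 < r ∧ (∀ y s, h (y + s • ν) = h y - s) ∧
      ∀ y ∈ ball x r, y ∈ Ω ↔ 0 < h y := by
  obtain ⟨ν, hν, γ, K, r, hγ, hr, hsub⟩ := hΩ.locally_subgraph x hx
  have hγP : LipschitzWith (K * ‖(ℝ ∙ ν)ᗮ.orthogonalProjectionOnto‖₊)
      (fun y => γ ((ℝ ∙ ν)ᗮ.orthogonalProjectionOnto y)) :=
    hγ.comp (ContinuousLinearMap.lipschitz _)
  have hin : LipschitzWith ‖innerSL ℝ ν‖₊ (fun y => inner ℝ ν y) :=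
    (innerSL ℝ ν).lipschitz
  refine ⟨ν, fun y => γ ((ℝ ∙ ν)ᗮ.orthogonalProjectionOnto y) - inner ℝ ν y, _, r, hν,
    hγP.sub hin, hr, fun y s => ?_, fun y hy => ?_⟩
  · have h0 : (ℝ ∙ ν)ᗮ.orthogonalProjectionOnto ν = 0 :=
      Submodule.orthogonalProjectionOnto_orthogonalComplement_singleton_eq_zero ν
    simp only [map_add, map_smul, h0, smul_zero, add_zero, inner_add_right, inner_smul_right,
      real_inner_self_eq_norm_sq, hν]
    ring
  · rw [hsub y hy, sub_pos]

section Height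

variable {n : ℕ} {Ω : Set (EuclideanSpace ℝ (Fin n))} {x₀ ν : EuclideanSpace ℝ (Fin n)}
  {h : EuclideanSpace ℝ (Fin n) → ℝ} {L : NNReal} {r : ℝ}

/-- The normalized negative gradient of the height function is the outer unit normal. -/
theorem isOuterUnitNormal_of_height (hhν : ∀ y s, h (y + s • ν) = h y - s)
    (hΩh : ∀ y ∈ ball x₀ r, y ∈ Ω ↔ 0 < h y) {p : EuclideanSpace ℝ (Fin n)}
    (hp : p ∈ ball x₀ r) (hp0 : h p = 0) (hd : DifferentiableAt ℝ h p) :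
    ∇ h p ≠ 0 ∧ IsOuterUnitNormal Ω p (-(‖∇ h p‖⁻¹ • ∇ h p)) := by
  have hm : ∇ h p ≠ 0 := by
    intro h0
    have h1 : fderiv ℝ h p ν = 0 := by
      have := inner_gradient_left (𝕜 := ℝ) (f := h) (x := p) (y := ν)
      rw [h0, inner_zero_left] at this
      exact this.symm
    have h2 : HasDerivAt (fun s : ℝ => h (p + s • ν)) (fderiv ℝ h p ν) 0 :=
      hd.hasFDerivAt.hasLineDerivAt ν
    have h3 : HasDerivAt (fun s : ℝ => h (p + s • ν)) (-1) 0 := by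
      simp only [hhν]
      simpa using (hasDerivAt_id (0 : ℝ)).const_sub (h p)
    have := h2.unique h3
    linarith
  have hmpos : 0 < ‖∇ h p‖ := norm_pos_iff.2 hm
  refine ⟨hm, by rw [norm_neg, norm_smul, norm_inv, norm_norm, inv_mul_cancel₀ hmpos.ne'],
    fun ε hε => ?_⟩
  -- Half of the cone margin `ε ‖∇ h p‖` absorbs the linearization error; the other half fixes the
  -- sign of `h y`.
  have hlit := hd.hasGradientAt.hasFDerivAt.isLittleO.def
    (show 0 < ε * ‖∇ h p‖ / 2 by positivity)
  obtain ⟨δ, hδ, hball⟩ := Metric.eventually_nhds_iff_ball.1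
    (hlit.and (isOpen_ball.mem_nhds hp))
  refine ⟨δ, hδ, fun y hy hyp => ?_⟩
  obtain ⟨h1, h2⟩ := hball y hy
  have hpos : 0 < ‖y - p‖ := norm_pos_iff.2 (sub_ne_zero.2 hyp)
  have hprod : 0 < ε * ‖∇ h p‖ * ‖y - p‖ := by positivity
  rw [hp0, InnerProductSpace.toDual_apply_apply, sub_zero, Real.norm_eq_abs, abs_le] at h1
  have hin : inner ℝ (-(‖∇ h p‖⁻¹ • ∇ h p)) (y - p) = -(‖∇ h p‖⁻¹ * inner ℝ (∇ h p) (y - p)) := by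
    rw [inner_neg_left, real_inner_smul_left]
  rw [hin, hΩh y h2]
  constructor
  · intro h3
    have h4 : ε * ‖y - p‖ ≤ ‖∇ h p‖⁻¹ * inner ℝ (∇ h p) (y - p) := by linarith
    rw [inv_mul_eq_div, le_div_iff₀ hmpos] at h4
    linarith [h1.1]
  · intro h3
    have h4 : ε * ‖y - p‖ ≤ -inner ℝ (∇ h p) (y - p) / ‖∇ h p‖ := by
      rw [neg_div, div_eq_inv_mul]; exact h3
    rw [le_div_iff₀ hmpos] at h4
    linarith [h1.2]

/-- Moving by `-s • ν` raises `h` to `s > 0`, so `p` is a limit of points of `Ω`, while `h p = 0`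
excludes `p` itself. -/
theorem mem_frontier_of_height (hΩ : IsOpen Ω) (hhν : ∀ y s, h (y + s • ν) = h y - s)
    (hΩh : ∀ y ∈ ball x₀ r, y ∈ Ω ↔ 0 < h y) {p : EuclideanSpace ℝ (Fin n)}
    (hp : p ∈ ball x₀ r) (hp0 : h p = 0) : p ∈ frontier Ω := by
  rw [hΩ.frontier_eq]
  refine ⟨?_, fun hpΩ => ((hΩh p hp).1 hpΩ).ne' hp0⟩
  have hc : Filter.Tendsto (fun s : ℝ => p + (-s) • ν) (𝓝[>] 0) (𝓝 p) := by
    have : Continuous fun s : ℝ => p + (-s) • ν := by fun_prop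
    simpa using (this.tendsto 0).mono_left nhdsWithin_le_nhds
  refine mem_closure_of_tendsto hc ?_
  filter_upwards [hc.eventually (isOpen_ball.mem_nhds hp), self_mem_nhdsWithin] with s hs hs0
  rw [hΩh _ hs, hhν, hp0]
  simpa using hs0

/-- The normal component of a field tangential to the boundary vanishes to first order. -/
theorem abs_fderiv_height_le (hΩ : IsOpen Ω) (hν : ‖ν‖ = 1) (hh : LipschitzWith L h)
    (hhν : ∀ y s, h (y + s • ν) = h y - s) (hΩh : ∀ y ∈ ball x₀ r, y ∈ Ω ↔ 0 < h y)
    {F : EuclideanSpace ℝ (Fin n) → EuclideanSpace ℝ (Fin n)} {C : ℝ}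
    (hF : ContDiffOn ℝ 1 F Ω) (hFc : ContinuousOn F (closure Ω))
    (hC : ∀ x ∈ Ω, ‖fderiv ℝ F x‖ ≤ C)
    (htan : ∀ p ∈ frontier Ω, ∀ N, IsOuterUnitNormal Ω p N → inner ℝ (F p) N = 0)
    {y : EuclideanSpace ℝ (Fin n)} (hy : y ∈ ball x₀ (r / 2)) (hyΩ : y ∈ Ω) (hyr : h y < r / 2)
    (hd : DifferentiableAt ℝ h y) : |fderiv ℝ h y (F y)| ≤ L * C * h y := by
  have hr : 0 < r := by
    have := nonempty_ball.1 ⟨y, hy⟩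
    linarith
  have hy0 : 0 < h y := (hΩh y (ball_subset_ball (by linarith) hy)).1 hyΩ
  have hball : ∀ s ∈ Icc 0 (h y), y + s • ν ∈ ball x₀ r := fun s hs => by
    have h1 : dist (y + s • ν) y = s := by
      rw [dist_eq_norm, add_sub_cancel_left, norm_smul, hν, mul_one, Real.norm_eq_abs,
        abs_of_nonneg hs.1]
    have := dist_triangle (y + s • ν) y x₀
    rw [mem_ball] at hy ⊢
    linarith [hs.2]
  have hin : ∀ s ∈ Ico 0 (h y), y + s • ν ∈ Ω := fun s hs => by
    rw [hΩh _ (hball s ⟨hs.1, hs.2.le⟩), hhν]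
    linarith [hs.2]
  -- The boundary point vertically above `y`. As `h` changes only by a constant under vertical
  -- shifts, it has the same derivative at `p` as at `y`, so the normal at `p` controls `fderiv ℝ h
  -- y`.
  set p := y + h y • ν with hp
  have hpb : p ∈ ball x₀ r := hball _ ⟨hy0.le, le_rfl⟩
  have hp0 : h p = 0 := by rw [hp, hhν]; ring
  have hpf := mem_frontier_of_height hΩ hhν hΩh hpb hp0
  have hdp : HasFDerivAt h (fderiv ℝ h y) p := by
    have h1 : h = fun z => h (z - h y • ν) - h y := by
      funext z
      have := hhν (z - h y • ν) (h y)
      rwa [sub_add_cancel] at this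
    have h2 : HasFDerivAt (fun z => h (z - h y • ν)) (fderiv ℝ h y) p := by
      have h3 : HasFDerivAt h (fderiv ℝ h y) (p - h y • ν) := by
        rw [hp, add_sub_cancel_right]
        exact hd.hasFDerivAt
      have h4 := h3.comp p ((hasFDerivAt_id p).sub_const (h y • ν))
      rw [ContinuousLinearMap.comp_id] at h4
      exact h4
    exact (h2.sub_const (h y)).congr_of_eventuallyEq (.of_eq h1)
  obtain ⟨hm, hN⟩ := isOuterUnitNormal_of_height hhν hΩh hpb hp0 hdp.differentiableAt
  have hzero : fderiv ℝ h y (F p) = 0 := by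
    have h1 := htan p hpf _ hN
    rw [inner_neg_right, real_inner_smul_right, neg_eq_zero, mul_eq_zero] at h1
    have h2 := h1.resolve_left (inv_ne_zero (norm_ne_zero_iff.2 hm))
    rw [real_inner_comm, inner_gradient_left, hdp.fderiv] at h2
    exact h2
  have hcl : ∀ s ∈ Icc 0 (h y), y + s • ν ∈ closure Ω := fun s hs => by
    rcases hs.2.lt_or_eq with h' | h'
    · exact subset_closure (hin s ⟨hs.1, h'⟩)
    · rw [h']; exact frontier_subset_closure hpf
  have hline : ∀ s : ℝ, HasDerivAt (fun s : ℝ => y + s • ν) ν s := fun s => by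
    simpa using ((hasDerivAt_id s).smul_const ν).const_add y
  -- Only the endpoint `p` leaves `Ω`: continuity on the closed segment and derivatives on the
  -- half-open one give `‖F p - F y‖ ≤ C * h y`.
  have hmv := norm_image_sub_le_of_norm_deriv_right_le_segment (a := 0) (b := h y)
    (f := fun s => F (y + s • ν)) (f' := fun s => fderiv ℝ F (y + s • ν) ν) (C := C)
    (hFc.comp (by fun_prop) hcl)
    (fun s hs => by
      have hdF : HasFDerivAt F (fderiv ℝ F (y + s • ν)) (y + s • ν) :=
        ((hF.contDiffAt (hΩ.mem_nhds (hin s hs))).differentiableAt (by simp)).hasFDerivAt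
      exact (hdF.comp_hasDerivAt s (hline s)).hasDerivWithinAt)
    (fun s hs => by
      refine (ContinuousLinearMap.le_opNorm _ _).trans ?_
      rw [hν, mul_one]
      exact hC _ (hin s hs))
    (h y) ⟨hy0.le, le_rfl⟩
  simp only [zero_smul, add_zero, sub_zero] at hmv
  have h3 : fderiv ℝ h y (F y) = -fderiv ℝ h y (F p - F y) := by
    rw [map_sub, hzero]; ring
  rw [h3, abs_neg, mul_assoc]
  refine ((fderiv ℝ h y).le_opNorm _).trans ?_
  exact mul_le_mul (norm_fderiv_le_of_lipschitz ℝ hh) hmv (norm_nonneg _) L.2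

end Height

/-! ### Removing the cutoff and gluing -/

section Flux

variable {n : ℕ} {Ω : Set (EuclideanSpace ℝ (Fin n))}
  {F : EuclideanSpace ℝ (Fin n) → EuclideanSpace ℝ (Fin n)} {v : EuclideanSpace ℝ (Fin n) → ℝ}
  {g : EuclideanSpace ℝ (Fin n) → EuclideanSpace ℝ (Fin n)}

theorem measurable_divergence (F : EuclideanSpace ℝ (Fin n) → EuclideanSpace ℝ (Fin n)) :
    Measurable (divergence F) :=
  Finset.measurable_sum _ fun i _ =>
    (EuclideanSpace.proj (𝕜 := ℝ) i : EuclideanSpace ℝ (Fin n) →L[ℝ] ℝ).continuous.measurable.comp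
      (measurable_fderiv_apply_const ℝ F _)

theorem abs_divergence_le {x : EuclideanSpace ℝ (Fin n)} {C : ℝ} (hC : ‖fderiv ℝ F x‖ ≤ C) :
    |divergence F x| ≤ n * C := by
  refine (Finset.abs_sum_le_sum_abs _ _).trans ?_
  refine (Finset.sum_le_card_nsmul _ _ C fun i _ => ?_).trans (by simp)
  refine (PiLp.norm_apply_le _ i).trans (((fderiv ℝ F x).le_opNorm _).trans ?_)
  simpa using hC

theorem aestronglyMeasurable_fluxIntegrand {μ : Measure (EuclideanSpace ℝ (Fin n))}
    (hF : AEStronglyMeasurable F μ) (hv : AEStronglyMeasurable v μ)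
    (hg : AEStronglyMeasurable g μ) {ψ : EuclideanSpace ℝ (Fin n) → ℝ} (hψ : Continuous ψ) :
    AEStronglyMeasurable (fluxIntegrand F v g ψ) μ := by
  have h1 : AEStronglyMeasurable (fun x => fderiv ℝ ψ x (F x)) μ :=
    isBoundedBilinearMap_apply.continuous.comp_aestronglyMeasurable
      ((measurable_fderiv ℝ ψ).aestronglyMeasurable.prodMk hF)
  have h2 : AEStronglyMeasurable ψ μ := hψ.aestronglyMeasurable
  exact (((h2.mul (measurable_divergence F).aestronglyMeasurable).add h1).mul hv).add
    (h2.mul (hF.inner hg))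

/-- `B` bounds the derivative only in direction `F x`: for the boundary cutoffs the full gradient
may blow up, but this component does not. -/
theorem norm_fluxIntegrand_le {ψ : EuclideanSpace ℝ (Fin n) → ℝ} {x : EuclideanSpace ℝ (Fin n)}
    {A B M D : ℝ} (hA : |ψ x| ≤ A) (hB : |fderiv ℝ ψ x (F x)| ≤ B) (hM : ‖F x‖ ≤ M)
    (hD : |divergence F x| ≤ D) :
    ‖fluxIntegrand F v g ψ x‖ ≤ (A * D + B) * ‖v x‖ + A * M * ‖g x‖ := by
  have hA0 := (abs_nonneg _).trans hA
  refine (norm_add_le _ _).trans (add_le_add ?_ ?_)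
  · rw [norm_mul]
    refine mul_le_mul_of_nonneg_right ((norm_add_le _ _).trans (add_le_add ?_ hB)) (norm_nonneg _)
    rw [norm_mul]
    exact mul_le_mul hA hD (abs_nonneg _) hA0
  · rw [norm_mul, mul_assoc]
    refine mul_le_mul hA ((norm_inner_le_norm _ _).trans ?_) (norm_nonneg _) hA0
    exact mul_le_mul_of_nonneg_right hM (norm_nonneg _)

theorem fluxIntegrand_congr {ψ φ : EuclideanSpace ℝ (Fin n) → ℝ} {x : EuclideanSpace ℝ (Fin n)}
    (h : ψ =ᶠ[𝓝 x] φ) : fluxIntegrand F v g ψ x = fluxIntegrand F v g φ x := by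
  simp only [fluxIntegrand, h.eq_of_nhds, h.fderiv_eq]

theorem fluxIntegrand_add {ψ φ : EuclideanSpace ℝ (Fin n) → ℝ} (hψ : Differentiable ℝ ψ)
    (hφ : Differentiable ℝ φ) (x : EuclideanSpace ℝ (Fin n)) :
    fluxIntegrand F v g (fun y => ψ y + φ y) x =
      fluxIntegrand F v g ψ x + fluxIntegrand F v g φ x := by
  simp only [fluxIntegrand, fderiv_fun_add (hψ x) (hφ x), add_apply]
  ring

theorem integrableOn_fluxIntegrand (hΩ : IsOpen Ω) (hΩb : Bornology.IsBounded Ω)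
    (hF : ContinuousOn F (closure Ω)) {C : ℝ} (hC : ∀ x ∈ Ω, ‖fderiv ℝ F x‖ ≤ C)
    (hv : IntegrableOn v Ω) (hg : IntegrableOn g Ω) {ψ : EuclideanSpace ℝ (Fin n) → ℝ}
    (hψ : ContDiff ℝ ∞ ψ) : IntegrableOn (fluxIntegrand F v g ψ) Ω := by
  have hK : IsCompact (closure Ω) := hΩb.isCompact_closure
  obtain ⟨M, hM⟩ := hK.exists_bound_of_continuousOn hF
  obtain ⟨A, hA⟩ := hK.exists_bound_of_continuousOn hψ.continuous.continuousOn
  obtain ⟨B, hB⟩ := hK.exists_bound_of_continuousOn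
    ((hψ.continuous_fderiv (by simp)).continuousOn.clm_apply hF)
  refine ((hv.norm.const_mul (A * (n * C) + B)).add (hg.norm.const_mul (A * M))).mono'
    (aestronglyMeasurable_fluxIntegrand ?_ hv.aestronglyMeasurable hg.aestronglyMeasurable
      hψ.continuous) ?_
  · exact (hF.mono subset_closure).aestronglyMeasurable hΩ.measurableSet
  · filter_upwards [ae_restrict_mem hΩ.measurableSet] with x hx
    have hx' := subset_closure hx
    exact norm_fluxIntegrand_le (hA x hx') (hB x hx') (hM x hx') (abs_divergence_le (hC x hx))

/-- The divergence theorem without boundary term, localized near a boundary point. -/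
theorem integral_fluxIntegrand_of_boundary_chart (hΩ : IsOpen Ω) (hΩb : Bornology.IsBounded Ω)
    (hF : ContDiffOn ℝ 1 F Ω) (hFc : ContinuousOn F (closure Ω)) {C : ℝ}
    (hC : ∀ x ∈ Ω, ‖fderiv ℝ F x‖ ≤ C)
    (htan : ∀ p ∈ frontier Ω, ∀ N, IsOuterUnitNormal Ω p N → inner ℝ (F p) N = 0)
    (hvg : IsH1WithGradient Ω v g) (hv : IntegrableOn v Ω) (hg : IntegrableOn g Ω)
    {x₀ ν : EuclideanSpace ℝ (Fin n)} {h : EuclideanSpace ℝ (Fin n) → ℝ} {L : NNReal} {r : ℝ}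
    (hν : ‖ν‖ = 1) (hh : LipschitzWith L h) (hr : 0 < r) (hhν : ∀ y s, h (y + s • ν) = h y - s)
    (hΩh : ∀ y ∈ ball x₀ r, y ∈ Ω ↔ 0 < h y) {ψ : EuclideanSpace ℝ (Fin n) → ℝ}
    (hψ : ContDiff ℝ ∞ ψ) (hψc : HasCompactSupport ψ) (hψr : tsupport ψ ⊆ ball x₀ (r / 2)) :
    ∫ x in Ω, fluxIntegrand F v g ψ x = 0 := by
  have hψr' : tsupport ψ ⊆ ball x₀ r := hψr.trans (ball_subset_ball (by linarith))
  obtain ⟨Mθ, hθ⟩ := exists_lipschitzWith_smoothTransition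
  -- With `ε k ≤ r / 8` the layer `h ≤ 2 * ε k` lies in `h < r / 2`, where the vertical segment to
  -- the boundary stays in the chart.
  let ε : ℕ → ℝ := fun k => r / 8 / (k + 1)
  have hε : ∀ k, 0 < ε k := fun k => by positivity
  have hεr : ∀ k, ε k ≤ r / 8 := fun k => div_le_self (by positivity) (by simp)
  have hε0 : Filter.Tendsto ε Filter.atTop (𝓝 0) := by
    have := (tendsto_one_div_add_atTop_nhds_zero_nat (𝕜 := ℝ)).const_mul (r / 8)
    simpa [ε, div_eq_mul_inv] using this
  let χ : ℕ → EuclideanSpace ℝ (Fin n) → ℝ := fun k y => Real.smoothTransition (h y / ε k - 1)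
  have hχ0 : ∀ k y, h y < ε k → χ k y = 0 := fun k y hy => by
    refine Real.smoothTransition.zero_of_nonpos ?_
    rw [sub_nonpos, div_le_one (hε k)]
    exact hy.le
  have hχ1 : ∀ k y, 2 * ε k < h y → χ k y = 1 := fun k y hy => by
    refine Real.smoothTransition.one_of_one_le ?_
    rw [le_sub_iff_add_le, le_div_iff₀ (hε k)]
    linarith
  have hχb : ∀ k y, |χ k y| ≤ 1 := fun k y => by
    rw [abs_of_nonneg (Real.smoothTransition.nonneg _)]
    exact Real.smoothTransition.le_one _
  have hχL : ∀ k, ∃ D, LipschitzWith D (χ k) := fun k => by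
    have h1 : LipschitzWith (L * (ε k)⁻¹.toNNReal) (fun y => h y / ε k - 1) := by
      refine LipschitzWith.of_dist_le_mul fun y z => ?_
      have h2 := hh.dist_le_mul y z
      rw [Real.dist_eq] at h2 ⊢
      have h3 : h y / ε k - 1 - (h z / ε k - 1) = (ε k)⁻¹ * (h y - h z) := by ring
      rw [h3, abs_mul, abs_of_pos (inv_pos.2 (hε k)), NNReal.coe_mul,
        Real.coe_toNNReal _ (inv_pos.2 (hε k)).le, mul_comm (L : ℝ), mul_assoc]
      exact mul_le_mul_of_nonneg_left h2 (inv_pos.2 (hε k)).le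
    exact ⟨_, hθ.comp h1⟩
  obtain ⟨Dψ, hDψ⟩ := hψ.lipschitzWith_of_hasCompactSupport hψc (by simp)
  obtain ⟨A, hA⟩ := hψ.continuous.bounded_above_of_compact_support hψc
  obtain ⟨M, hM⟩ := hΩb.isCompact_closure.exists_bound_of_continuousOn hFc
  have hA0 : 0 ≤ A := (norm_nonneg _).trans (hA x₀)
  let w : ℕ → EuclideanSpace ℝ (Fin n) → ℝ := fun k y => ψ y * χ k y
  have hwL : ∀ k, ∃ D, LipschitzWith D (w k) := fun k => by
    obtain ⟨D, hD⟩ := hχL k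
    exact exists_lipschitzWith_mul hDψ hD hA (hχb k)
  have hwz : ∀ k, ∫ x in Ω, fluxIntegrand F v g (w k) x = 0 := fun k => by
    obtain ⟨D, hD⟩ := hwL k
    refine integral_fluxIntegrand_of_compactSupport hΩ hF hvg hv hg hD hψc.mul_right ?_
    -- The closed condition `ε k ≤ h` passes to the topological support, which therefore stays off
    -- the boundary.
    have hcl : tsupport (w k) ⊆ {y | ε k ≤ h y} :=
      closure_minimal (fun y hy => mem_ofPred_eq ▸ (not_lt.1 fun hlt => hy (by simp [w, hχ0 k y hlt])))
        (isClosed_le continuous_const hh.continuous)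
    intro y hy
    exact (hΩh y (hψr' (closure_mono (Function.support_mul_subset_left _ _) hy))).2
      ((hε k).trans_le (hcl hy))
  have hlim : Filter.Tendsto (fun k => ∫ x in Ω, fluxIntegrand F v g (w k) x) Filter.atTop
      (𝓝 (∫ x in Ω, fluxIntegrand F v g ψ x)) := by
    refine tendsto_integral_of_dominated_convergence
      (fun x => (A * (n * C) + (A * (Mθ * (2 * (L * C))) + Dψ * M)) * ‖v x‖ + A * M * ‖g x‖)
      (fun k => ?_) ((hv.norm.const_mul _).add (hg.norm.const_mul _)) (fun k => ?_) ?_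
    · obtain ⟨D, hD⟩ := hwL k
      exact aestronglyMeasurable_fluxIntegrand
        ((hFc.mono subset_closure).aestronglyMeasurable hΩ.measurableSet)
        hv.aestronglyMeasurable hg.aestronglyMeasurable hD.continuous
    · filter_upwards [ae_restrict_mem hΩ.measurableSet,
        ae_restrict_of_ae (hh.ae_differentiableAt (μ := volume))] with x hx hdx
      have hMx := hM x (subset_closure hx)
      have hM0 : 0 ≤ M := (norm_nonneg _).trans hMx
      have hC0 : 0 ≤ C := (norm_nonneg _).trans (hC x hx)
      refine norm_fluxIntegrand_le ?_ ?_ hMx (abs_divergence_le (hC x hx))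
      · rw [abs_mul]
        exact (mul_le_mul (hA x) (hχb k x) (abs_nonneg _) hA0).trans (mul_one A).le
      by_cases hxψ : x ∈ tsupport ψ
      swap
      · have h0 : w k =ᶠ[𝓝 x] fun _ => 0 := by
          filter_upwards [notMem_tsupport_iff_eventuallyEq.1 hxψ] with y hy
          simp [w, hy]
        rw [h0.fderiv_eq]
        simp only [fderiv_fun_const, Pi.zero_apply, zero_apply, abs_zero]
        positivity
      have hx0 : 0 < h x := (hΩh x (hψr' hxψ)).1 hx
      have hinner : HasFDerivAt (fun y => h y / ε k - 1) ((ε k)⁻¹ • fderiv ℝ h x) x := by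
        simpa [div_eq_inv_mul] using (hdx.hasFDerivAt.const_mul (ε k)⁻¹).sub_const 1
      have hθd : HasDerivAt Real.smoothTransition
          (deriv Real.smoothTransition (h x / ε k - 1)) (h x / ε k - 1) :=
        ((Real.smoothTransition.contDiff (n := 1)).differentiable (by simp) _).hasDerivAt
      have hχd : HasFDerivAt (χ k) (deriv Real.smoothTransition (h x / ε k - 1) •
          ((ε k)⁻¹ • fderiv ℝ h x)) x :=
        HasDerivAt.comp_hasFDerivAt (f := fun y => h y / ε k - 1) x hθd hinner
      have hχF : |fderiv ℝ (χ k) x (F x)| ≤ Mθ * (2 * (L * C)) := by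
        by_cases hx2 : 2 * ε k < h x
        · have h1 : χ k =ᶠ[𝓝 x] fun _ => 1 := by
            filter_upwards [hh.continuous.continuousAt.eventually (lt_mem_nhds hx2)] with y hy
            exact hχ1 k y hy
          rw [h1.fderiv_eq]
          simp only [fderiv_fun_const, Pi.zero_apply, zero_apply, abs_zero]
          positivity
        -- In the layer, the factor `(ε k)⁻¹` from the cutoff is cancelled by `h x ≤ 2 * ε k` in the
        -- tangency estimate.
        · have hx3 : h x ≤ 2 * ε k := not_lt.1 hx2
          have h1 := abs_fderiv_height_le hΩ hν hh hhν hΩh hF hFc hC htan (hψr hxψ) hx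
            (by linarith [hεr k]) hdx
          have h2 : |deriv Real.smoothTransition (h x / ε k - 1)| ≤ Mθ :=
            norm_deriv_le_of_lipschitz hθ
          rw [hχd.fderiv]
          simp only [smul_apply, smul_eq_mul, abs_mul, abs_of_pos (inv_pos.2 (hε k))]
          refine mul_le_mul h2 ?_ (by positivity) Mθ.2
          rw [inv_mul_le_iff₀ (hε k)]
          refine h1.trans ((mul_le_mul_of_nonneg_left hx3 (by positivity)).trans (le_of_eq ?_))
          ring
      have hψF : |fderiv ℝ ψ x (F x)| ≤ Dψ * M :=
        ((fderiv ℝ ψ x).le_opNorm _).trans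
          (mul_le_mul (norm_fderiv_le_of_lipschitz ℝ hDψ) hMx (norm_nonneg _) Dψ.2)
      have hwd : fderiv ℝ (w k) x (F x) =
          ψ x * fderiv ℝ (χ k) x (F x) + χ k x * fderiv ℝ ψ x (F x) := by
        simp only [w]
        rw [fderiv_fun_mul (hψ.differentiable (by simp) x) hχd.differentiableAt]
        simp only [add_apply, smul_apply, smul_eq_mul]
      rw [hwd]
      refine (abs_add_le _ _).trans (add_le_add ?_ ?_)
      · rw [abs_mul]
        exact mul_le_mul (hA x) hχF (abs_nonneg _) hA0
      · rw [abs_mul]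
        exact (mul_le_mul (hχb k x) hψF (abs_nonneg _) zero_le_one).trans (one_mul _).le
    · filter_upwards [ae_restrict_mem hΩ.measurableSet] with x hx
      -- At each fixed `x` the integrands are eventually equal to the limit, since `2 * ε k < h x`
      -- for large `k`.
      refine tendsto_const_nhds.congr' ?_
      by_cases hxψ : x ∈ tsupport ψ
      · have hx0 : 0 < h x := (hΩh x (hψr' hxψ)).1 hx
        have h2ε : Filter.Tendsto (fun k => 2 * ε k) Filter.atTop (𝓝 0) := by
          simpa using hε0.const_mul 2
        filter_upwards [h2ε.eventually (gt_mem_nhds hx0)] with k hk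
        refine fluxIntegrand_congr ?_
        filter_upwards [hh.continuous.continuousAt.eventually (lt_mem_nhds hk)] with y hy
        simp [w, hχ1 k y hy]
      · refine .of_forall fun k => fluxIntegrand_congr ?_
        filter_upwards [notMem_tsupport_iff_eventuallyEq.1 hxψ] with y hy
        simp [w, hy]
  simp only [hwz] at hlim
  exact (tendsto_nhds_unique tendsto_const_nhds hlim).symm

/-- The divergence theorem on a bounded Lipschitz domain for a field tangential to the boundary. -/
theorem integral_divergence_mul_add_inner (hΩ : IsBoundedLipschitzDomain Ω)
    (hF : ContDiffOn ℝ 1 F Ω) (hFc : ContinuousOn F (closure Ω)) {C : ℝ}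
    (hC : ∀ x ∈ Ω, ‖fderiv ℝ F x‖ ≤ C)
    (htan : ∀ p ∈ frontier Ω, ∀ N, IsOuterUnitNormal Ω p N → inner ℝ (F p) N = 0)
    (hvg : IsH1WithGradient Ω v g) (hv : IntegrableOn v Ω) (hg : IntegrableOn g Ω) :
    ∫ x in Ω, (divergence F x * v x + inner ℝ (F x) (g x)) = 0 := by
  have hloc : ∀ x ∈ closure Ω, ∃ ρ > 0, ∀ ψ : EuclideanSpace ℝ (Fin n) → ℝ, ContDiff ℝ ∞ ψ →
      HasCompactSupport ψ → tsupport ψ ⊆ ball x ρ → ∫ x in Ω, fluxIntegrand F v g ψ x = 0 := by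
    intro x hx
    by_cases hxΩ : x ∈ Ω
    · obtain ⟨ρ, hρ, hball⟩ := Metric.isOpen_iff.1 hΩ.isOpen x hxΩ
      refine ⟨ρ, hρ, fun ψ hψ hψc hψρ => ?_⟩
      obtain ⟨D, hD⟩ := hψ.lipschitzWith_of_hasCompactSupport hψc (by simp)
      exact integral_fluxIntegrand_of_compactSupport hΩ.isOpen hF hvg hv hg hD hψc
        (hψρ.trans hball)
    · have hxf : x ∈ frontier Ω := by
        rw [hΩ.isOpen.frontier_eq]; exact ⟨hx, hxΩ⟩
      obtain ⟨ν, h, L, r, hν, hh, hr, hhν, hΩh⟩ := hΩ.exists_height hxf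
      exact ⟨r / 2, by positivity, fun ψ hψ hψc hψr =>
        integral_fluxIntegrand_of_boundary_chart hΩ.isOpen hΩ.isBounded hF hFc hC htan hvg hv hg
          hν hh hr hhν hΩh hψ hψc hψr⟩
  have hpatch : ∃ η : EuclideanSpace ℝ (Fin n) → ℝ, ContDiff ℝ ∞ η ∧ (∀ x ∈ closure Ω, η x = 1) ∧
      ∀ ψ : EuclideanSpace ℝ (Fin n) → ℝ, ContDiff ℝ ∞ ψ →
        ∫ x in Ω, fluxIntegrand F v g (fun y => η y * ψ y) x = 0 := by
    -- Compact induction replaces a partition of unity. Allowing every smooth `ψ` is what makes the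
    -- property stable under unions.
    refine hΩ.isBounded.isCompact_closure.induction_on
      (p := fun s => ∃ η : EuclideanSpace ℝ (Fin n) → ℝ, ContDiff ℝ ∞ η ∧ (∀ x ∈ s, η x = 1) ∧
        ∀ ψ : EuclideanSpace ℝ (Fin n) → ℝ, ContDiff ℝ ∞ ψ →
          ∫ x in Ω, fluxIntegrand F v g (fun y => η y * ψ y) x = 0) ?_ ?_ ?_ ?_
    · exact ⟨fun _ => 0, contDiff_const, by simp, fun ψ _ => by simp [fluxIntegrand]⟩
    · rintro s t hst ⟨η, h1, h2, h3⟩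
      exact ⟨η, h1, fun x hx => h2 x (hst hx), h3⟩
    · rintro s t ⟨η, h1, h2, h3⟩ ⟨η', h1', h2', h3'⟩
      -- This is `1 - (1 - η)(1 - η')`; the second summand is handled by testing `η'` with `(1 - η)
      -- ψ`.
      refine ⟨fun y => η y + η' y * (1 - η y), h1.add (h1'.mul (contDiff_const.sub h1)), ?_,
        fun ψ hψ => ?_⟩
      · rintro x (hx | hx)
        · simp [h2 x hx]
        · simp [h2' x hx]
      · have hs1 : ContDiff ℝ ∞ fun y => η y * ψ y := h1.mul hψ
        have hs0 : ContDiff ℝ ∞ fun y => (1 - η y) * ψ y := (contDiff_const.sub h1).mul hψ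
        have hs2 : ContDiff ℝ ∞ fun y => η' y * ((1 - η y) * ψ y) := h1'.mul hs0
        have heq : (fun y => (η y + η' y * (1 - η y)) * ψ y) =
            fun y => η y * ψ y + η' y * ((1 - η y) * ψ y) := by
          funext y; ring
        have hI := fun {φ : EuclideanSpace ℝ (Fin n) → ℝ} (hφ : ContDiff ℝ ∞ φ) =>
          integrableOn_fluxIntegrand hΩ.isOpen hΩ.isBounded hFc hC hv hg hφ
        simp only [heq, fluxIntegrand_add (hs1.differentiable (by simp))
          (hs2.differentiable (by simp))]
        rw [integral_add (hI hs1) (hI hs2), h3 ψ hψ, h3' _ hs0, add_zero]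
    · intro x hx
      obtain ⟨ρ, hρ, hρψ⟩ := hloc x hx
      let f : ContDiffBump x := ⟨ρ / 4, ρ / 2, by positivity, by linarith⟩
      refine ⟨closedBall x (ρ / 4), mem_nhdsWithin_of_mem_nhds (closedBall_mem_nhds x (by positivity)),
        f, f.contDiff, fun y hy => f.one_of_mem_closedBall hy, fun ψ hψ => ?_⟩
      refine hρψ _ (f.contDiff.mul hψ) f.hasCompactSupport.mul_right ?_
      refine (closure_mono (Function.support_mul_subset_left _ _)).trans ?_
      change tsupport f ⊆ _
      rw [f.tsupport_eq]
      exact closedBall_subset_ball (half_lt_self hρ)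
  obtain ⟨η, -, hη1, hη⟩ := hpatch
  rw [← hη (fun _ => 1) contDiff_const]
  refine setIntegral_congr_fun hΩ.isOpen.measurableSet fun x hx => ?_
  have hev : (fun y => η y * 1) =ᶠ[𝓝 x] fun _ => 1 := by
    filter_upwards [hΩ.isOpen.mem_nhds hx] with y hy
    simp [hη1 y (subset_closure hy)]
  have hflux := fluxIntegrand_congr (F := F) (v := v) (g := g) hev
  simp only [hflux]
  simp [fluxIntegrand]

end Flux

/-! ### Application to the Neumann problem -/

theorem divergence_congr {n : ℕ} {F G : EuclideanSpace ℝ (Fin n) → EuclideanSpace ℝ (Fin n)}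
    {x : EuclideanSpace ℝ (Fin n)} (h : F =ᶠ[𝓝 x] G) : divergence F x = divergence G x := by
  simp only [divergence, h.fderiv_eq]

theorem divergence_const_smul {n : ℕ} (α : ℝ)
    {F : EuclideanSpace ℝ (Fin n) → EuclideanSpace ℝ (Fin n)} {x : EuclideanSpace ℝ (Fin n)}
    (hF : DifferentiableAt ℝ F x) : divergence (fun y => α • F y) x = α * divergence F x := by
  simp only [divergence, fderiv_fun_const_smul hF, Finset.mul_sum]
  rfl

theorem mainTheorem7 (n : ℕ) (hn : 1 ≤ n) (hn3 : n ≤ 3)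
    (Ω : Set (EuclideanSpace ℝ (Fin n))) (hΩ : IsBoundedLipschitzDomain Ω)
    (α β : ℝ) (hα : 0 < α) (hβ : 0 < β)
    (c d : ℝ → ℝ) (hc : Continuous c) (hd : ContDiff ℝ 1 d)
    (T : ℝ) (hT : 0 < T) (S : ℝ → EuclideanSpace ℝ (Fin n) → ℝ)
    (hS : IsSmoothSolution T Ω α β c d S) :
    ∀ (v : EuclideanSpace ℝ (Fin n) → ℝ)
      (gradv : EuclideanSpace ℝ (Fin n) → EuclideanSpace ℝ (Fin n)),
      IsH1WithGradient Ω v gradv →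
      ∀ t ∈ Ioc 0 T,
        IntegrableOn (fun x => (c ‖∇ (S t) x‖ * timeDeriv T S t x) * v x) Ω ∧
        IntegrableOn (fun x => inner ℝ (α • ∇ (S t) x) (gradv x)) Ω ∧
        IntegrableOn (fun x => (β * deriv d (S t x)) * v x) Ω ∧
        (∫ x in Ω, (c ‖∇ (S t) x‖ * timeDeriv T S t x) * v x) +
          (∫ x in Ω, inner ℝ (α • ∇ (S t) x) (gradv x)) +
          (∫ x in Ω, (β * deriv d (S t x)) * v x) = 0 := by
  intro v gradv hv t ht
  have htI : t ∈ Icc 0 T := Ioc_subset_Icc_self ht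
  have hK : IsCompact (closure Ω) := hΩ.isBounded.isCompact_closure
  have hms := hΩ.isOpen.measurableSet
  have hfin : IsFiniteMeasure (volume.restrict Ω) :=
    isFiniteMeasure_restrict.2 hΩ.isBounded.measure_lt_top.ne
  have hv1 : IntegrableOn v Ω := hv.memLp.integrable (by norm_num)
  have hg1 : IntegrableOn gradv Ω := hv.memLp_gradient.integrable (by norm_num)
  have hslice : ContinuousOn (fun x : EuclideanSpace ℝ (Fin n) => (t, x)) (closure Ω) := by
    fun_prop
  have hmaps : MapsTo (fun x : EuclideanSpace ℝ (Fin n) => (t, x)) (closure Ω)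
      (Icc 0 T ×ˢ closure Ω) := fun x hx => ⟨htI, hx⟩
  have hnhds : ∀ x ∈ Ω, closure Ω ∈ 𝓝 x := fun x hx =>
    Filter.mem_of_superset (hΩ.isOpen.mem_nhds hx) subset_closure
  -- The derivative within the closure is continuous up to the boundary and carries the Neumann
  -- condition; `∇ (S t)` is known to agree with it only in `Ω`.
  set Φ : EuclideanSpace ℝ (Fin n) → (EuclideanSpace ℝ (Fin n) →L[ℝ] ℝ) :=
    fderivWithin ℝ (S t) (closure Ω) with hΦ
  -- The Riesz isometry, bundled as a real-linear map so that smoothness and derivative bounds of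
  -- `Φ` transfer to `F`.
  let J : (EuclideanSpace ℝ (Fin n) →L[ℝ] ℝ) →ₗᵢ[ℝ] EuclideanSpace ℝ (Fin n) :=
    { toFun := (InnerProductSpace.toDual ℝ (EuclideanSpace ℝ (Fin n))).symm
      map_add' := map_add _
      map_smul' := fun a T => by simp
      norm_map' := fun T => LinearIsometryEquiv.norm_map _ T }
  let F : EuclideanSpace ℝ (Fin n) → EuclideanSpace ℝ (Fin n) := fun x => J (Φ x)
  have hΦc : ContinuousOn Φ (closure Ω) := hS.isC12.continuousOn_fderiv.comp hslice hmaps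
  have hFc : ContinuousOn F (closure Ω) := J.continuous.comp_continuousOn hΦc
  have hFgrad : ∀ x ∈ Ω, F x = ∇ (S t) x := fun x hx => by
    simp only [F, hΦ, fderivWithin_of_mem_nhds (hnhds x hx)]
    rfl
  have hSΩ : ContDiffOn ℝ 2 (S t) Ω := (hS.isC12.contDiffOn_space t htI).mono subset_closure
  have hΦ1 : ContDiffOn ℝ 1 Φ Ω :=
    (hSΩ.fderiv_of_isOpen hΩ.isOpen (by norm_num)).congr fun x hx =>
      fderivWithin_of_mem_nhds (hnhds x hx)
  have hF1 : ContDiffOn ℝ 1 F Ω := J.toContinuousLinearMap.contDiff.comp_contDiffOn hΦ1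
  have hΦ' : ContinuousOn (fderivWithin ℝ Φ (closure Ω)) (closure Ω) :=
    hS.isC12.continuousOn_fderiv_fderiv.comp hslice hmaps
  obtain ⟨C, hC⟩ := hK.exists_bound_of_continuousOn
    (E := EuclideanSpace ℝ (Fin n) →L[ℝ] EuclideanSpace ℝ (Fin n) →L[ℝ] ℝ) hΦ'
  have hFC : ∀ x ∈ Ω, ‖fderiv ℝ F x‖ ≤ C := fun x hx => by
    have h1 := hC x (subset_closure hx)
    have h2 : DifferentiableAt ℝ Φ x :=
      (hΦ1.contDiffAt (hΩ.isOpen.mem_nhds hx)).differentiableAt (by simp)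
    have h3 : HasFDerivAt F (J.toContinuousLinearMap.comp (fderiv ℝ Φ x)) x :=
      J.toContinuousLinearMap.hasFDerivAt.comp x h2.hasFDerivAt
    rw [fderivWithin_of_mem_nhds (hnhds x hx)] at h1
    rw [h3.fderiv]
    refine ContinuousLinearMap.opNorm_le_bound _ ((norm_nonneg _).trans h1) fun y => ?_
    change ‖J (fderiv ℝ Φ x y)‖ ≤ _
    rw [J.norm_map]
    exact (fderiv ℝ Φ x).le_of_opNorm_le h1 y
  have htan : ∀ p ∈ frontier Ω, ∀ N, IsOuterUnitNormal Ω p N → inner ℝ (F p) N = 0 :=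
    fun p hp N hN => by
      rw [show inner ℝ (F p) N = Φ p N from InnerProductSpace.toDual_symm_apply]
      exact (mul_eq_zero.1 (hS.neumann t ht p hp N hN)).resolve_left hα.ne'
  have hflux := integral_divergence_mul_add_inner hΩ hF1 hFc hFC htan hv hv1 hg1
  have hbdd : ∀ {f : EuclideanSpace ℝ (Fin n) → ℝ}, ContinuousOn f (closure Ω) →
      IntegrableOn (fun x => f x * v x) Ω := fun {f} hf => by
    obtain ⟨A, hA⟩ := hK.exists_bound_of_continuousOn hf
    refine hv1.bdd_mul (c := A) ((hf.mono subset_closure).aestronglyMeasurable hms) ?_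
    filter_upwards [ae_restrict_mem hms] with x hx
    exact hA x (subset_closure hx)
  have hI1 : IntegrableOn (fun x => (c ‖∇ (S t) x‖ * timeDeriv T S t x) * v x) Ω := by
    have hcont : ContinuousOn (fun x => c ‖F x‖ * timeDeriv T S t x) (closure Ω) :=
      (hc.comp_continuousOn hFc.norm).mul (hS.isC12.continuousOn_timeDeriv.comp hslice hmaps)
    refine (hbdd hcont).congr_fun (fun x hx => ?_) hms
    simp only [hFgrad x hx]
  have hI2 : IntegrableOn (fun x => inner ℝ (F x) (gradv x)) Ω := by
    obtain ⟨A, hA⟩ := hK.exists_bound_of_continuousOn hFc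
    refine (hg1.norm.const_mul A).mono'
      (((hFc.mono subset_closure).aestronglyMeasurable hms).inner hg1.aestronglyMeasurable) ?_
    filter_upwards [ae_restrict_mem hms] with x hx
    exact (norm_inner_le_norm _ _).trans
      (mul_le_mul_of_nonneg_right (hA x (subset_closure hx)) (norm_nonneg _))
  have hI2' : IntegrableOn (fun x => inner ℝ (α • ∇ (S t) x) (gradv x)) Ω := by
    refine IntegrableOn.congr_fun (hI2.const_mul α) (fun x hx => ?_) hms
    simp only [← hFgrad x hx, real_inner_smul_left]
  have hI3 : IntegrableOn (fun x => (β * deriv d (S t x)) * v x) Ω :=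
    hbdd (continuousOn_const.mul ((hd.continuous_deriv (by simp)).comp_continuousOn
      (hS.isC12.continuousOn.comp hslice hmaps)))
  refine ⟨hI1, hI2', hI3, ?_⟩
  have heq : ∫ x in Ω, ((c ‖∇ (S t) x‖ * timeDeriv T S t x) * v x +
      inner ℝ (α • ∇ (S t) x) (gradv x) + (β * deriv d (S t x)) * v x) =
      ∫ x in Ω, α * (divergence F x * v x + inner ℝ (F x) (gradv x)) := by
    refine setIntegral_congr_fun hms fun x hx => ?_
    have hev : F =ᶠ[𝓝 x] ∇ (S t) := by
      filter_upwards [hΩ.isOpen.mem_nhds hx] with y hy using hFgrad y hy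
    have hdF : DifferentiableAt ℝ F x :=
      (hF1.contDiffAt (hΩ.isOpen.mem_nhds hx)).differentiableAt (by simp)
    have hdiv : divergence (fun y => α • ∇ (S t) y) x = α * divergence F x := by
      rw [← divergence_const_smul α hdF]
      exact divergence_congr (hev.symm.fun_const_smul α)
    have heqn := hS.equation t ht x hx
    rw [hdiv] at heqn
    simp only [real_inner_smul_left, hFgrad x hx]
    -- The pointwise equation times `v` turns the three integrands into `α` times the flux integrand
    -- of `F`.
    linear_combination v x * heqn
  have hI12 : IntegrableOn (fun x => (c ‖∇ (S t) x‖ * timeDeriv T S t x) * v x +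
      inner ℝ (α • ∇ (S t) x) (gradv x)) Ω := hI1.add hI2'
  rw [integral_const_mul, hflux, mul_zero, integral_add hI12 hI3,
    integral_add hI1 hI2'] at heq
  exact heq
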